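/- **Lemma (Coercivity of $a_h^{ub}$).** Let $\Omega\subset\mathbb R^2$ be open and bounded and let $\mathcal M$ be a face-to-face triangulation of $\Omega$, i.e. a finite set of nondegenerate closed triangles whose interiors are contained in $\Omega$, whose union is $\overline\Omega$, and any two different of which meet in the convex hull of their common vertices (for instance, any face-to-face simplicial mesh of a bounded polygonal Lipschitz domain). Let $\ell\ge 2$ be an integer. Notation. For an open set $U$ triangulated by $\mathcal N$ and an integer $m\geq 0$, let $P_m^{0}(\mathcal N)$ be the space of all $q\in L^2(U)$ that coincide on each triangle of $\mathcal N$ with a polynomial of total degree $\le m$, let $\widehat P_m^{0}(\mathcal N)=\{q\in P_m^0(\mathcal N):\int_U q=0\}$, and let $\mathring P_m^{1}(\mathcal N)=P^0_m(\mathcal N)\cap H^1(U)\cap H^1_0(U)$, where $H^1_0(U)$ is the closure of $C_c^\infty(U)$ in $H^1(U)$. Put $V_h=\mathring P_\ell^1(\mathcal M)^2$ and $Q_h=\widehat P_{\ell-2}^0(\mathcal M)$, and let $\operatorname{div}_h v_h\in Q_h$ be defined by $\int_\Omega q_h\operatorname{div}_h v_h=\int_\Omega q_h\operatorname{div}v_h$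 for all $q_h\in Q_h$. For $K\in\mathcal M$ let $\mathcal M_K$ be its barycentric refinement (the three triangles obtained by connecting the vertices of $K$ with its barycenter). Let $R_\ell^K:L^2(\Omega)\to H^1_0(\Omega)^2$ be the linear operator that maps $q$ to the extension by zero of $u_K$, where $(u_K,p_K)\in \mathring P_\ell^1(\mathcal M_K)^2\times \widehat P_{\ell-1}^0(\mathcal M_K)$ is the solution of $$\int_K\nabla u_K:\nabla v_K-\int_K p_K\operatorname{div}v_K=0\quad\forall v_K\in\mathring P_\ell^1(\mathcal M_K)^2,\qquad \int_K q_K\operatorname{div}u_K=\int_K q_K\,q\quad\forall q_K\in\widehat P_{\ell-1}^0(\mathcal M_K).$$ Set $R_h^{ub}v_h=\sum_{K\in\mathcal M}R_\ell^K(\operatorname{div}_hv_h-\operatorname{div}v_h)$ and, for a penalty parameter $\eta$ and $w_h,v_h\in V_h$, $$a_h^{ub}(w_h,v_h)=\int_\Omega\nabla w_h:\nabla v_h+\int_\Omega\nabla w_h:\nabla R_h^{ub}v_h+\int_\Omega\nabla R_h^{ub}w_h:\nabla v_h+\eta\int_\Omega\nabla R_h^{ub}w_h:\nabla R_h^{ub}v_h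 .$$ Claim. For every $\eta>1$ the bilinear form $a_h^{ub}$ is coercive on $V_h$ with respect to the norm $\|\nabla\cdot\|_{L^2(\Omega)}$, i.e. there is $\alpha>0$ with $a_h^{ub}(v_h,v_h)\ge\alpha\|\nabla v_h\|_{L^2(\Omega)}^2$ for all $v_h\in V_h$; more precisely, $$a_h^{ub}(v_h,v_h)\ \ge\ \Bigl(1-\frac1\eta\Bigr)\|\nabla v_h\|_{L^2(\Omega)}^2\qquad\text{for all }v_h\in V_h .$$ -/

import Mathlib

noncomputable section

namespace Stokes

open MeasureTheory

open scoped ContDiff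

/-- The Euclidean plane. -/
abbrev Plane := EuclideanSpace ℝ (Fin 2)

/-- `L²(U)` (scalar for `F = ℝ`, vector valued for `F = Plane`). -/
abbrev L2 (U : Set Plane) (F : Type) [NormedAddCommGroup F] := Lp F 2 (volume.restrict U)

/-- Pairs `(u, g)` with `u ∈ L²(U)` and `g ∈ L²(U)²`. A Sobolev function is represented by the pair
`(u, ∇u)`, i.e. by a point of the graph of the weak gradient. -/
abbrev Pair (U : Set Plane) := L2 U ℝ × L2 U Plane

/-- `φ ∈ C_c^∞(U)`. -/
structure IsTest (U : Set Plane) (φ : Plane → ℝ) : Prop where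
  smooth : ContDiff ℝ ∞ φ
  compact : HasCompactSupport φ
  subset : tsupport φ ⊆ U

theorem IsTest.gradient_continuous {U : Set Plane} {φ : Plane → ℝ} (h : IsTest U φ) :
    Continuous (gradient φ) := by
  have := h.smooth.continuous_fderiv (by simp)
  exact (InnerProductSpace.toDual ℝ Plane).symm.continuous.comp this

theorem IsTest.gradient_compact {U : Set Plane} {φ : Plane → ℝ} (h : IsTest U φ) :
    HasCompactSupport (gradient φ) :=
  (h.compact.fderiv (𝕜 := ℝ)).comp_left (g := (InnerProductSpace.toDual ℝ Plane).symm) (by simp)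

/-- `g` is the weak gradient of `u` in `U`:
`∫_U u ∂ᵢφ = - ∫_U gᵢ φ` for all `φ ∈ C_c^∞(U)` and all `i`. -/
def IsWeakGradient (U : Set Plane) (u : L2 U ℝ) (g : L2 U Plane) : Prop :=
  ∀ φ : Plane → ℝ, IsTest U φ → ∀ i : Fin 2,
    ∫ x in U, u x * (gradient φ x) i = - ∫ x in U, (g x) i * φ x

/-- The coordinate `x ↦ xᵢ`. -/
abbrev coordCLM (i : Fin 2) : Plane →L[ℝ] ℝ := EuclideanSpace.proj i

theorem memLp_coord {U : Set Plane} {g : Plane → Plane} (hg : MemLp g 2 (volume.restrict U))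
    (i : Fin 2) : MemLp (fun x => (g x) i) 2 (volume.restrict U) :=
  (coordCLM i).comp_memLp' hg

theorem IsTest.memLp {U : Set Plane} {φ : Plane → ℝ} (h : IsTest U φ) :
    MemLp φ 2 (volume.restrict U) :=
  h.smooth.continuous.memLp_of_hasCompactSupport h.compact

theorem IsTest.memLp_gradient {U : Set Plane} {φ : Plane → ℝ} (h : IsTest U φ) :
    MemLp (gradient φ) 2 (volume.restrict U) :=
  h.gradient_continuous.memLp_of_hasCompactSupport h.gradient_compact

/-- The Sobolev space `H¹(U)`, as the set of all pairs `(u, ∇u)`. -/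
def H1 (U : Set Plane) : Submodule ℝ (Pair U) where
  carrier := {z | IsWeakGradient U z.1 z.2}
  zero_mem' := by
    intro φ hφ i
    have h1 : ∫ x in U, (0 : L2 U ℝ) x * (gradient φ x) i = ∫ x in U, (0 : ℝ) := by
      refine integral_congr_ae ?_
      filter_upwards [Lp.coeFn_zero ℝ 2 (volume.restrict U)] with x hx
      rw [hx]; simp
    have h2 : ∫ x in U, ((0 : L2 U Plane) x) i * φ x = ∫ x in U, (0 : ℝ) := by
      refine integral_congr_ae ?_
      filter_upwards [Lp.coeFn_zero Plane 2 (volume.restrict U)] with x hx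
      rw [hx]; simp
    simp only [Prod.fst_zero, Prod.snd_zero]
    rw [h1, h2]; simp
  add_mem' := by
    intro a b ha hb φ hφ i
    have h1 : ∫ x in U, (a.1 + b.1 : L2 U ℝ) x * (gradient φ x) i
        = (∫ x in U, a.1 x * (gradient φ x) i) + ∫ x in U, b.1 x * (gradient φ x) i := by
      refine Eq.trans ?_ (integral_add
        ((Lp.memLp a.1).integrable_mul (memLp_coord hφ.memLp_gradient i))
        ((Lp.memLp b.1).integrable_mul (memLp_coord hφ.memLp_gradient i)))
      refine integral_congr_ae ?_
      filter_upwards [Lp.coeFn_add a.1 b.1] with x hx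
      rw [hx]; simp [add_mul]
    have h2 : ∫ x in U, ((a.2 + b.2 : L2 U Plane) x) i * φ x
        = (∫ x in U, (a.2 x) i * φ x) + ∫ x in U, (b.2 x) i * φ x := by
      refine Eq.trans ?_ (integral_add ((memLp_coord (Lp.memLp a.2) i).integrable_mul hφ.memLp)
        ((memLp_coord (Lp.memLp b.2) i).integrable_mul hφ.memLp))
      refine integral_congr_ae ?_
      filter_upwards [Lp.coeFn_add a.2 b.2] with x hx
      rw [hx]; simp [add_mul]
    simp only [Prod.fst_add, Prod.snd_add]
    rw [h1, h2, ha φ hφ i, hb φ hφ i]; ring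
  smul_mem' := by
    intro c a ha φ hφ i
    have h1 : ∫ x in U, (c • a.1 : L2 U ℝ) x * (gradient φ x) i
        = c * ∫ x in U, a.1 x * (gradient φ x) i := by
      rw [← integral_const_mul]
      refine integral_congr_ae ?_
      filter_upwards [Lp.coeFn_smul c a.1] with x hx
      rw [hx]; simp [mul_assoc]
    have h2 : ∫ x in U, ((c • a.2 : L2 U Plane) x) i * φ x
        = c * ∫ x in U, (a.2 x) i * φ x := by
      rw [← integral_const_mul]
      refine integral_congr_ae ?_
      filter_upwards [Lp.coeFn_smul c a.2] with x hx
      rw [hx]; simp [mul_assoc]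
    simp only [Prod.smul_fst, Prod.smul_snd]
    rw [h1, h2, ha φ hφ i]; ring

/-- The pairs `(φ, ∇φ)` with `φ ∈ C_c^∞(U)`. -/
def testPairs (U : Set Plane) : Set (Pair U) :=
  {z | ∃ φ : Plane → ℝ, IsTest U φ ∧ (z.1 =ᵐ[volume.restrict U] φ) ∧
    (z.2 =ᵐ[volume.restrict U] gradient φ)}

/-- `H¹₀(U)`: the closure of `C_c^∞(U)` in the `H¹`-norm. -/
def H10 (U : Set Plane) : Submodule ℝ (Pair U) :=
  (Submodule.span ℝ (testPairs U)).topologicalClosure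

/-- `∫_U ∇w : ∇v`, for vector fields `w = (w₀, w₁)`, `v = (v₀, v₁)`; the gradient of the
`i`-th component is `(v i).2`. -/
def gradForm (U : Set Plane) : LinearMap.BilinForm ℝ (Fin 2 → Pair U) :=
  have key : ∀ w v : Fin 2 → Pair U,
      ∫ x in U, ∑ i, inner ℝ ((w i).2 x) ((v i).2 x) = ∑ i, inner ℝ (w i).2 (v i).2 := by
    intro w v
    rw [integral_finsetSum _ fun i _ => L2.integrable_inner (𝕜 := ℝ) (w i).2 (v i).2]
    simp only [L2.inner_def]
  LinearMap.mk₂ ℝ (fun w v => ∫ x in U, ∑ i, inner ℝ ((w i).2 x) ((v i).2 x))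
    (fun a b c => by simp only [key]; simp [inner_add_left]; ring)
    (fun a b c => by simp only [key]; simp [inner_smul_left]; ring)
    (fun a b c => by simp only [key]; simp [inner_add_right]; ring)
    (fun a b c => by simp only [key]; simp [inner_smul_right]; ring)

/-- `‖∇v‖_{L²(U)}`. -/
def gradNorm (U : Set Plane) (v : Fin 2 → Pair U) : ℝ :=
  Real.sqrt (∫ x in U, ∑ i, ‖(v i).2 x‖ ^ 2)

/-- `div v = ∂₀ v₀ + ∂₁ v₁`. -/
def divergence (U : Set Plane) : (Fin 2 → Pair U) →ₗ[ℝ] L2 U ℝ :=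
  ∑ i : Fin 2, (ContinuousLinearMap.compLpₗ 2 (volume.restrict U)
      (coordCLM i)) ∘ₗ
    LinearMap.snd ℝ (L2 U ℝ) (L2 U Plane) ∘ₗ LinearMap.proj i

/-- The closed triangle with the given set of vertices. -/
abbrev hull (K : Finset Plane) : Set Plane := convexHull ℝ (K : Set Plane)

/-- The open triangle with the given set of vertices. -/
abbrev openHull (K : Finset Plane) : Set Plane := interior (hull K)

/-- `u` is almost everywhere on `U` equal, on each of the triangles in `M`, to some polynomial of
total degree at most `ℓ`. -/
def IsPiecewisePoly (U : Set Plane) (M : Finset (Finset Plane)) (ℓ : ℕ) (u : L2 U ℝ) : Prop :=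
  ∀ K ∈ M, ∃ p : MvPolynomial (Fin 2) ℝ, p.totalDegree ≤ ℓ ∧
    ∀ᵐ x ∂(volume.restrict U), x ∈ hull K → u x = MvPolynomial.eval (fun i => x i) p

theorem IsPiecewisePoly.zero (U : Set Plane) (M : Finset (Finset Plane)) (ℓ : ℕ) :
    IsPiecewisePoly U M ℓ 0 := fun K _ => by
  refine ⟨0, by simp, ?_⟩
  filter_upwards [Lp.coeFn_zero ℝ 2 (volume.restrict U)] with x hx _
  rw [hx]; simp

theorem IsPiecewisePoly.add {U : Set Plane} {M : Finset (Finset Plane)} {ℓ : ℕ} {u v : L2 U ℝ}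
    (hu : IsPiecewisePoly U M ℓ u) (hv : IsPiecewisePoly U M ℓ v) :
    IsPiecewisePoly U M ℓ (u + v) := fun K hK => by
  obtain ⟨p, hp, hpu⟩ := hu K hK
  obtain ⟨q, hq, hqv⟩ := hv K hK
  refine ⟨p + q, (MvPolynomial.totalDegree_add p q).trans (max_le hp hq), ?_⟩
  filter_upwards [Lp.coeFn_add u v, hpu, hqv] with x hx h1 h2 hxK
  rw [hx, Pi.add_apply, h1 hxK, h2 hxK, map_add]

theorem IsPiecewisePoly.smul {U : Set Plane} {M : Finset (Finset Plane)} {ℓ : ℕ} {u : L2 U ℝ}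
    (c : ℝ) (hu : IsPiecewisePoly U M ℓ u) : IsPiecewisePoly U M ℓ (c • u) := fun K hK => by
  obtain ⟨p, hp, hpu⟩ := hu K hK
  refine ⟨c • p, (MvPolynomial.totalDegree_smul_le c p).trans hp, ?_⟩
  filter_upwards [Lp.coeFn_smul c u, hpu] with x hx h1 hxK
  rw [hx, Pi.smul_apply, h1 hxK, MvPolynomial.smul_eval, smul_eq_mul]

/-- Piecewise polynomials of degree at most `ℓ` in `L²(U)`. -/
def PolyL2 (U : Set Plane) (M : Finset (Finset Plane)) (ℓ : ℕ) : Submodule ℝ (L2 U ℝ) where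
  carrier := {u | IsPiecewisePoly U M ℓ u}
  zero_mem' := .zero U M ℓ
  add_mem' := fun hu hv => hu.add hv
  smul_mem' := fun c _ hu => hu.smul c

/-- `L²₀(U)`: the functions in `L²(U)` with vanishing integral (on a set of finite measure, where
every `L²` function is integrable). -/
def L2avg (U : Set Plane) [Fact (volume U < ⊤)] : Submodule ℝ (L2 U ℝ) where
  carrier := {q | ∫ x in U, q x = 0}
  zero_mem' := by
    have : ∫ x in U, (0 : L2 U ℝ) x = ∫ x in U, (0 : ℝ) :=
      integral_congr_ae (Lp.coeFn_zero ℝ 2 (volume.restrict U))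
    simpa using this
  add_mem' := by
    intro a b ha hb
    have h : ∫ x in U, (a + b : L2 U ℝ) x = (∫ x in U, a x) + ∫ x in U, b x := by
      rw [← integral_add ((Lp.memLp a).integrable (by norm_num))
        ((Lp.memLp b).integrable (by norm_num))]
      exact integral_congr_ae (Lp.coeFn_add a b)
    simp only [Set.mem_ofPred_eq] at ha hb ⊢
    rw [h, ha, hb, add_zero]
  smul_mem' := by
    intro c a ha
    have h : ∫ x in U, (c • a : L2 U ℝ) x = c * ∫ x in U, a x := by
      rw [← integral_const_mul]
      exact integral_congr_ae (Lp.coeFn_smul c a)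
    simp only [Set.mem_ofPred_eq] at ha ⊢
    rw [h, ha, mul_zero]

/-- Piecewise polynomials of degree at most `ℓ` in `L²₀(U)`. -/
def PolyAvg (U : Set Plane) [Fact (volume U < ⊤)] (M : Finset (Finset Plane)) (ℓ : ℕ) :
    Submodule ℝ (L2 U ℝ) :=
  PolyL2 U M ℓ ⊓ L2avg U

/-- Piecewise polynomials of degree at most `ℓ` in `H¹(U)`. -/
def PolyH1 (U : Set Plane) (M : Finset (Finset Plane)) (ℓ : ℕ) : Submodule ℝ (Pair U) :=
  H1 U ⊓ (PolyL2 U M ℓ).comap (LinearMap.fst ℝ (L2 U ℝ) (L2 U Plane))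

/-- Piecewise polynomials of degree at most `ℓ` in `H¹₀(U)`. -/
def PolyH10 (U : Set Plane) (M : Finset (Finset Plane)) (ℓ : ℕ) : Submodule ℝ (Pair U) :=
  PolyH1 U M ℓ ⊓ H10 U

/-- The vector field whose components lie in the given space. -/
def toPair {U : Set Plane} (S : Submodule ℝ (Pair U)) : (Fin 2 → S) →ₗ[ℝ] (Fin 2 → Pair U) :=
  LinearMap.compLeft S.subtype (Fin 2)

open Classical in
/-- The barycentric refinement of a triangle: its barycenter is connected with each vertex, i.e.
each vertex in turn is replaced by the barycenter. -/
def baryRefinement (K : Finset Plane) : Finset (Finset Plane) :=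
  K.image fun a => insert ((3 : ℝ)⁻¹ • ∑ b ∈ K, b) (K.erase a)

/-- A face-to-face triangulation of `Ω`. Triangles are given by their sets of vertices; two
different ones meet in the convex hull of their common vertices (so in nothing, in a common vertex
or in a common edge). The elements are contained in `Ω` up to their boundary and cover its closure,
so `Ω` is a bounded polygonal set. -/
structure Triangulation (Ω : Set Plane) where
  elements : Finset (Finset Plane)
  card_eq : ∀ K ∈ elements, K.card = 3
  affineIndependent : ∀ K ∈ elements, AffineIndependent ℝ ((↑) : K → Plane)
  openHull_subset : ∀ K ∈ elements, openHull K ⊆ Ω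
  cover : ⋃ K ∈ elements, hull K = closure Ω
  face_to_face : ∀ K ∈ elements, ∀ K' ∈ elements, K ≠ K' →
    hull K ∩ hull K' = convexHull ℝ ((K : Set Plane) ∩ (K' : Set Plane))

theorem isCompact_hull (K : Finset Plane) : IsCompact (hull K) :=
  K.finite_toSet.isCompact_convexHull (𝕜 := ℝ)

instance (K : Finset Plane) : Fact (volume (openHull K) < ⊤) :=
  ⟨(measure_mono interior_subset).trans_lt (isCompact_hull K).measure_lt_top⟩

theorem Triangulation.volume_lt_top {Ω : Set Plane} (T : Triangulation Ω) : volume Ω < ⊤ := by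
  have h : IsCompact (⋃ K ∈ T.elements, hull K) :=
    T.elements.isCompact_biUnion fun K _ => isCompact_hull K
  rw [T.cover] at h
  exact (measure_mono subset_closure).trans_lt h.measure_lt_top

/-- Restriction `L²(Ω) → L²(U)` for `U ⊆ Ω`. -/
def restrictL2 {U Ω : Set Plane} (h : U ⊆ Ω) : L2 Ω ℝ →ₗ[ℝ] L2 U ℝ where
  toFun q := ((Lp.memLp q).mono_measure (Measure.restrict_mono_set volume h)).toLp q
  map_add' a b := by
    rw [← MemLp.toLp_add]
    exact MemLp.toLp_congr _ _
      (ae_mono (Measure.restrict_mono_set volume h) (Lp.coeFn_add a b))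
  map_smul' c a := by
    rw [RingHom.id_apply, ← MemLp.toLp_const_smul]
    exact MemLp.toLp_congr _ _
      (ae_mono (Measure.restrict_mono_set volume h) (Lp.coeFn_smul c a))

theorem restrictL2_ae {U Ω : Set Plane} (h : U ⊆ Ω) (q : L2 Ω ℝ) :
    restrictL2 h q =ᵐ[volume.restrict U] q :=
  MemLp.coeFn_toLp ((Lp.memLp q).mono_measure (Measure.restrict_mono_set volume h))

theorem memLp_zeroExtend {F : Type} [NormedAddCommGroup F] {U Ω : Set Plane}
    (hU : MeasurableSet U) (h : U ⊆ Ω) (f : L2 U F) :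
    MemLp (U.indicator f) 2 (volume.restrict Ω) := by
  rw [memLp_indicator_iff_restrict hU, Measure.restrict_restrict hU,
    Set.inter_eq_self_of_subset_left h]
  exact Lp.memLp f

/-- Extension by zero `L²(U) → L²(Ω)` for `U ⊆ Ω`. -/
def zeroExtendL2 (F : Type) [NormedAddCommGroup F] [NormedSpace ℝ F] {U Ω : Set Plane}
    (hU : MeasurableSet U) (h : U ⊆ Ω) : L2 U F →ₗᵢ[ℝ] L2 Ω F where
  toFun f := (memLp_zeroExtend hU h f).toLp _
  map_add' a b := by
    rw [← MemLp.toLp_add]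
    refine MemLp.toLp_congr _ _ ?_
    have := (ae_restrict_iff' hU).1 (Lp.coeFn_add a b)
    filter_upwards [ae_restrict_of_ae this] with x hx
    by_cases hxU : x ∈ U
    · rw [Pi.add_apply, Set.indicator_of_mem hxU, Set.indicator_of_mem hxU,
        Set.indicator_of_mem hxU, hx hxU, Pi.add_apply]
    · rw [Pi.add_apply, Set.indicator_of_notMem hxU, Set.indicator_of_notMem hxU,
        Set.indicator_of_notMem hxU, add_zero]
  map_smul' c a := by
    rw [RingHom.id_apply, ← MemLp.toLp_const_smul]
    refine MemLp.toLp_congr _ _ ?_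
    have := (ae_restrict_iff' hU).1 (Lp.coeFn_smul c a)
    filter_upwards [ae_restrict_of_ae this] with x hx
    by_cases hxU : x ∈ U
    · simp [hxU, hx hxU]
    · simp [hxU]
  norm_map' a := by
    change ‖(memLp_zeroExtend hU h a).toLp _‖ = ‖a‖
    rw [Lp.norm_toLp, eLpNorm_indicator_eq_eLpNorm_restrict hU, Measure.restrict_restrict hU,
      Set.inter_eq_self_of_subset_left h, Lp.norm_def]

theorem zeroExtendL2_ae {F : Type} [NormedAddCommGroup F] [NormedSpace ℝ F] {U Ω : Set Plane}
    (hU : MeasurableSet U) (h : U ⊆ Ω) (f : L2 U F) :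
    zeroExtendL2 F hU h f =ᵐ[volume.restrict Ω] U.indicator f :=
  MemLp.coeFn_toLp (memLp_zeroExtend hU h f)

/-- Extension by zero of a pair, `(u, ∇u) ↦ (ū, ∇ū)`. -/
def zeroExtendPair {U Ω : Set Plane} (hU : MeasurableSet U) (h : U ⊆ Ω) :
    Pair U →L[ℝ] Pair Ω :=
  (zeroExtendL2 ℝ hU h).toContinuousLinearMap.prodMap
    (zeroExtendL2 Plane hU h).toContinuousLinearMap

theorem zeroExtendPair_fst_ae {U Ω : Set Plane} (hU : MeasurableSet U) (h : U ⊆ Ω) (z : Pair U) :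
    (zeroExtendPair hU h z).1 =ᵐ[volume.restrict Ω] U.indicator z.1 :=
  zeroExtendL2_ae hU h z.1

theorem zeroExtendPair_snd_ae {U Ω : Set Plane} (hU : MeasurableSet U) (h : U ⊆ Ω) (z : Pair U) :
    (zeroExtendPair hU h z).2 =ᵐ[volume.restrict Ω] U.indicator z.2 :=
  zeroExtendL2_ae hU h z.2

theorem IsTest.gradient_eq_zero {U : Set Plane} {φ : Plane → ℝ} (hφ : IsTest U φ) {x : Plane}
    (hx : x ∉ U) : gradient φ x = 0 := by
  have hx0 : x ∉ tsupport (fderiv ℝ φ) := fun hh =>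
    hx (hφ.subset (tsupport_fderiv_subset ℝ hh))
  rw [gradient, image_eq_zero_of_notMem_tsupport hx0, map_zero]

theorem zeroExtendPair_testPairs {U Ω : Set Plane} (hU : MeasurableSet U) (h : U ⊆ Ω) {z : Pair U}
    (hz : z ∈ testPairs U) : zeroExtendPair hU h z ∈ testPairs Ω := by
  obtain ⟨φ, hφ, e1, e2⟩ := hz
  refine ⟨φ, ⟨hφ.smooth, hφ.compact, hφ.subset.trans h⟩, ?_, ?_⟩
  · refine (zeroExtendPair_fst_ae hU h z).trans ?_
    have := (ae_restrict_iff' hU).1 e1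
    filter_upwards [ae_restrict_of_ae this] with x hx
    by_cases hxU : x ∈ U
    · rw [Set.indicator_of_mem hxU, hx hxU]
    · rw [Set.indicator_of_notMem hxU,
        image_eq_zero_of_notMem_tsupport fun hh => hxU (hφ.subset hh)]
  · refine (zeroExtendPair_snd_ae hU h z).trans ?_
    have := (ae_restrict_iff' hU).1 e2
    filter_upwards [ae_restrict_of_ae this] with x hx
    by_cases hxU : x ∈ U
    · rw [Set.indicator_of_mem hxU, hx hxU]
    · rw [Set.indicator_of_notMem hxU, hφ.gradient_eq_zero hxU]

/-- A continuous linear map that maps `s` into `t` maps the closed span of `s` into that of `t`. -/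
theorem map_mem_closedSpan {A B : Type*} [NormedAddCommGroup A] [NormedSpace ℝ A]
    [NormedAddCommGroup B] [NormedSpace ℝ B] (f : A →L[ℝ] B) {s : Set A} {t : Set B}
    (h : ∀ a ∈ s, f a ∈ t) {z : A} (hz : z ∈ (Submodule.span ℝ s).topologicalClosure) :
    f z ∈ (Submodule.span ℝ t).topologicalClosure := by
  have h1 : Submodule.span ℝ s ≤ (Submodule.span ℝ t).comap f.toLinearMap :=
    Submodule.span_le.2 fun a ha => Submodule.subset_span (h a ha)
  have h2 : z ∈ closure (Submodule.span ℝ s : Set A) := hz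
  have h3 : f z ∈ closure (Submodule.span ℝ t : Set B) :=
    map_mem_closure f.continuous h2 fun a ha => h1 ha
  exact h3

theorem zeroExtendPair_mem {U Ω : Set Plane} (hU : MeasurableSet U) (h : U ⊆ Ω) {z : Pair U}
    (hz : z ∈ H10 U) : zeroExtendPair hU h z ∈ H10 Ω :=
  map_mem_closedSpan (zeroExtendPair hU h) (fun _ ha => zeroExtendPair_testPairs hU h ha) hz

/-- Extension by zero `H¹₀(U)² → H¹₀(Ω)²`, restricted to the piecewise polynomials. -/
def zeroExtend {U Ω : Set Plane} (hU : MeasurableSet U) (h : U ⊆ Ω)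
    (M : Finset (Finset Plane)) (ℓ : ℕ) :
    (Fin 2 → PolyH10 U M ℓ) →ₗ[ℝ] (Fin 2 → H10 Ω) :=
  LinearMap.compLeft ((zeroExtendPair hU h).toLinearMap.restrict
    fun _ hz => zeroExtendPair_mem hU h (Submodule.mem_inf.1 hz).2) (Fin 2)

/-- The Stokes-like problem in `U` with discrete velocity space `V²`, discrete pressure space `Q` and
datum `q` for the divergence: `u ∈ V²` and `p ∈ Q` satisfy
`∫ ∇u : ∇v - ∫ p div v = 0` for all `v ∈ V²` and `∫ r div u = ∫ r q` for all `r ∈ Q`. -/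
structure IsStokesSolution {U : Set Plane} (V : Submodule ℝ (Pair U)) (Q : Submodule ℝ (L2 U ℝ))
    (q : L2 U ℝ) (u : Fin 2 → V) (p : Q) : Prop where
  momentum : ∀ v : Fin 2 → V,
    gradForm U (toPair V u) (toPair V v) - ∫ x in U, p.1 x * divergence U (toPair V v) x = 0
  mass : ∀ r : Q, ∫ x in U, r.1 x * divergence U (toPair V u) x = ∫ x in U, r.1 x * q x

theorem integral_mul_eq_inner {U : Set Plane} (a b : L2 U ℝ) :
    ∫ x in U, a x * b x = inner ℝ a b := by
  rw [L2.inner_def]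
  exact integral_congr_ae (.of_forall fun x => by simp [mul_comm])

theorem integral_add_mul {U : Set Plane} (a b c : L2 U ℝ) :
    ∫ x in U, (a + b : L2 U ℝ) x * c x = (∫ x in U, a x * c x) + ∫ x in U, b x * c x := by
  simp only [integral_mul_eq_inner]
  exact inner_add_left a b c

theorem integral_mul_add {U : Set Plane} (a b c : L2 U ℝ) :
    ∫ x in U, c x * (a + b : L2 U ℝ) x = (∫ x in U, c x * a x) + ∫ x in U, c x * b x := by
  simp only [integral_mul_eq_inner]
  exact inner_add_right c a b

theorem integral_smul_mul {U : Set Plane} (t : ℝ) (a c : L2 U ℝ) :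
    ∫ x in U, (t • a : L2 U ℝ) x * c x = t * ∫ x in U, a x * c x := by
  simp only [integral_mul_eq_inner]
  exact real_inner_smul_left a c t

theorem integral_mul_smul {U : Set Plane} (t : ℝ) (a c : L2 U ℝ) :
    ∫ x in U, c x * (t • a : L2 U ℝ) x = t * ∫ x in U, c x * a x := by
  simp only [integral_mul_eq_inner]
  exact real_inner_smul_right c a t

section Saddle

variable {U : Set Plane} {V : Submodule ℝ (Pair U)} {Q : Submodule ℝ (L2 U ℝ)}

theorem toPair_add (u v : Fin 2 → V) : toPair V (u + v) = toPair V u + toPair V v :=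
  LinearMap.map_add _ u v

theorem toPair_smul (c : ℝ) (u : Fin 2 → V) : toPair V (c • u) = c • toPair V u :=
  LinearMap.map_smul _ c u

theorem toPair_zero : toPair V 0 = 0 := LinearMap.map_zero _

theorem IsStokesSolution.zero : IsStokesSolution V Q 0 0 0 := by
  constructor
  · intro v
    rw [integral_mul_eq_inner, toPair_zero, LinearMap.map_zero, LinearMap.zero_apply,
      Submodule.coe_zero, inner_zero_left, sub_zero]
  · intro r
    rw [integral_mul_eq_inner, integral_mul_eq_inner, toPair_zero, LinearMap.map_zero]

theorem IsStokesSolution.add {q q' : L2 U ℝ} {u u' : Fin 2 → V} {p p' : Q}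
    (h : IsStokesSolution V Q q u p) (h' : IsStokesSolution V Q q' u' p') :
    IsStokesSolution V Q (q + q') (u + u') (p + p') := by
  constructor
  · intro v
    have h1 := h.momentum v
    have h2 := h'.momentum v
    have h3 := integral_add_mul p.1 p'.1 (divergence U (toPair V v))
    have h4 := LinearMap.map_add₂ (gradForm U) (toPair V u) (toPair V u') (toPair V v)
    rw [toPair_add, h4, Submodule.coe_add, h3]
    linarith
  · intro r
    rw [toPair_add, LinearMap.map_add, integral_mul_add, integral_mul_add, h.mass r, h'.mass r]

theorem IsStokesSolution.smul (c : ℝ) {q : L2 U ℝ} {u : Fin 2 → V} {p : Q}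
    (h : IsStokesSolution V Q q u p) : IsStokesSolution V Q (c • q) (c • u) (c • p) := by
  constructor
  · intro v
    have h1 := h.momentum v
    have h3 := integral_smul_mul c p.1 (divergence U (toPair V v))
    have h4 := LinearMap.map_smul₂ (gradForm U) c (toPair V u) (toPair V v)
    rw [toPair_smul, h4, Submodule.coe_smul, h3, smul_eq_mul, ← mul_sub, h1, mul_zero]
  · intro r
    rw [toPair_smul, LinearMap.map_smul, integral_mul_smul, integral_mul_smul, h.mass r]

/-- The gradient of the velocity is determined by the datum. -/
theorem IsStokesSolution.gradForm_sub_eq_zero {q : L2 U ℝ} {u u' : Fin 2 → V} {p p' : Q}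
    (h : IsStokesSolution V Q q u p) (h' : IsStokesSolution V Q q u' p') :
    gradForm U (toPair V (u - u')) (toPair V (u - u')) = 0 := by
  have hd : IsStokesSolution V Q 0 (u - u') (p - p') := by
    have h1 := h.add (h'.smul (-1))
    have e1 : q + (-1 : ℝ) • q = 0 := by module
    have e2 : u + (-1 : ℝ) • u' = u - u' := by
      funext i
      change u i + (-1 : ℝ) • u' i = u i - u' i
      module
    have e3 : p + (-1 : ℝ) • p' = p - p' := by module
    rwa [e1, e2, e3] at h1
  have h2 := hd.mass (p - p')
  have h3 : ∫ x in U, (p - p').1 x * (0 : L2 U ℝ) x = 0 := by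
    rw [integral_mul_eq_inner]
    exact inner_zero_right _
  have h4 := hd.momentum (u - u')
  rwa [h2, h3, sub_zero] at h4

/-- A linear relation contains the graph of a linear map on its domain, and this map can be extended
to the whole space. -/
theorem exists_linear_selection {A B : Type*} [AddCommGroup A] [Module ℝ A] [AddCommGroup B]
    [Module ℝ B] (S : Submodule ℝ (A × B)) :
    ∃ f : A →ₗ[ℝ] B, ∀ a b, (a, b) ∈ S → (a, f a) ∈ S := by
  let π : S →ₗ[ℝ] A := LinearMap.fst ℝ A B ∘ₗ S.subtype
  obtain ⟨s, hs⟩ := π.rangeRestrict.exists_rightInverse_of_surjective π.range_rangeRestrict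
  obtain ⟨f, hf⟩ := LinearMap.exists_extend (LinearMap.snd ℝ A B ∘ₗ S.subtype ∘ₗ s)
  refine ⟨f, fun a b hab => ?_⟩
  have ha : a ∈ LinearMap.range π := ⟨⟨(a, b), hab⟩, rfl⟩
  have h1 : f a = (s ⟨a, ha⟩ : A × B).2 := congrArg (fun g => g ⟨a, ha⟩) hf
  have h2 : (s ⟨a, ha⟩ : A × B).1 = a :=
    congrArg Subtype.val (congrArg (fun g => g ⟨a, ha⟩) hs)
  have h3 : (a, f a) = (s ⟨a, ha⟩ : A × B) := Prod.ext h2.symm h1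
  rw [h3]
  exact (s ⟨a, ha⟩).2

variable (V Q)

/-- There is a linear map that solves the problem for all data for which it can be solved. -/
theorem exists_solutionOperator :
    ∃ f : L2 U ℝ →ₗ[ℝ] (Fin 2 → V) × Q,
      ∀ q u p, IsStokesSolution V Q q u p → IsStokesSolution V Q q (f q).1 (f q).2 := by
  let S : Submodule ℝ (L2 U ℝ × ((Fin 2 → V) × Q)) :=
    { carrier := {z | IsStokesSolution V Q z.1 z.2.1 z.2.2}
      zero_mem' := .zero
      add_mem' := fun ha hb => ha.add hb
      smul_mem' := fun c _ ha => ha.smul c }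
  obtain ⟨f, hf⟩ := exists_linear_selection S
  exact ⟨f, fun q u p h => hf q (u, p) h⟩

/-- The solution operator `q ↦ (u, p)` of the Stokes-like problem. When the problem has exactly one
solution for every datum, it is the only map with the property in `solutionOperator_spec`. -/
def solutionOperator : L2 U ℝ →ₗ[ℝ] (Fin 2 → V) × Q :=
  (exists_solutionOperator V Q).choose

theorem solutionOperator_spec {q : L2 U ℝ} {u : Fin 2 → V} {p : Q}
    (h : IsStokesSolution V Q q u p) :
    IsStokesSolution V Q q (solutionOperator V Q q).1 (solutionOperator V Q q).2 :=
  (exists_solutionOperator V Q).choose_spec q u p h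

end Saddle

/-- The solution operator `q ↦ (u_K, p_K)` of the local problem on the triangle `K`: velocities are
the `H¹₀`-conforming piecewise polynomials of degree at most `ℓ`, pressures the piecewise
polynomials of degree at most `ℓ - 1` with vanishing integral, both on the barycentric refinement of
`K`. (For a nondegenerate triangle and `1 ≤ ℓ`, this pair is inf-sup stable, so that the local
problem has exactly one solution for every datum.) -/
def localSolution (K : Finset Plane) (ℓ : ℕ) :
    L2 (openHull K) ℝ →ₗ[ℝ] (Fin 2 → PolyH10 (openHull K) (baryRefinement K) ℓ) ×
      PolyAvg (openHull K) (baryRefinement K) (ℓ - 1) :=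
  solutionOperator _ _

section Global

variable {Ω : Set Plane} (T : Triangulation Ω) (ℓ : ℕ)

/-- The local right inverse of the divergence `L²(Ω) → H¹₀(Ω)²`: `q` is mapped to `u_K(q)` in the
triangle `K` and to zero outside of it. -/
def localRightInverse (K : T.elements) : L2 Ω ℝ →ₗ[ℝ] (Fin 2 → H10 Ω) :=
  zeroExtend isOpen_interior.measurableSet (T.openHull_subset K K.2) (baryRefinement K) ℓ ∘ₗ
    LinearMap.fst ℝ _ _ ∘ₗ localSolution K ℓ ∘ₗ restrictL2 (T.openHull_subset K K.2)

/-- The discrete velocity space: `H¹₀`-conforming piecewise polynomials of degree at most `ℓ`. -/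
abbrev Vh := Fin 2 → PolyH10 Ω T.elements ℓ

/-- The discrete pressure space: piecewise polynomials of degree at most `ℓ - 2` with vanishing
integral. -/
def Qh : Submodule ℝ (L2 Ω ℝ) :=
  haveI : Fact (volume Ω < ⊤) := ⟨T.volume_lt_top⟩
  PolyAvg Ω T.elements (ℓ - 2)

theorem memLp_poly (K : Finset Plane) (p : MvPolynomial (Fin 2) ℝ) :
    MemLp (fun x : Plane => MvPolynomial.eval (fun i => x i) p) 2
      (volume.restrict (openHull K)) := by
  have hc : Continuous fun x : Plane => MvPolynomial.eval (fun i => x i) p :=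
    (MvPolynomial.continuous_eval p).comp (by fun_prop)
  obtain ⟨C, hC⟩ := (isCompact_hull K).exists_bound_of_continuousOn hc.continuousOn
  have : IsFiniteMeasure (volume.restrict (openHull K)) :=
    ⟨by simpa using (inferInstance : Fact (volume (openHull K) < ⊤)).out⟩
  refine MemLp.of_bound hc.aestronglyMeasurable C ?_
  filter_upwards [ae_restrict_mem isOpen_interior.measurableSet] with x hx
  exact hC x (interior_subset hx)

/-- A polynomial as an element of `L²` of an open triangle. -/
def polyToL2 (K : Finset Plane) :
    MvPolynomial (Fin 2) ℝ →ₗ[ℝ] L2 (openHull K) ℝ where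
  toFun p := (memLp_poly K p).toLp _
  map_add' p q := by
    rw [← MemLp.toLp_add]
    exact MemLp.toLp_congr _ _ (.of_forall fun x => by simp)
  map_smul' c p := by
    rw [RingHom.id_apply, ← MemLp.toLp_const_smul]
    exact MemLp.toLp_congr _ _ (.of_forall fun x => by simp [MvPolynomial.smul_eval])

theorem finiteDimensional_PolyL2 (m : ℕ) : FiniteDimensional ℝ (PolyL2 Ω T.elements m) := by
  let W : (K : T.elements) → Submodule ℝ (L2 (openHull K) ℝ) := fun K =>
    (MvPolynomial.restrictTotalDegree (Fin 2) ℝ m).map (polyToL2 K)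
  have hW : ∀ K, FiniteDimensional ℝ (W K) := fun K => inferInstance
  have hmem : ∀ (u : PolyL2 Ω T.elements m) (K : T.elements),
      restrictL2 (T.openHull_subset K K.2) u.1 ∈ W K := by
    intro u K
    obtain ⟨p, hp, hpu⟩ := u.2 K K.2
    refine ⟨p, (MvPolynomial.mem_restrictTotalDegree _ _ _).2 hp, ?_⟩
    refine Lp.ext ((MemLp.coeFn_toLp (memLp_poly K p)).trans ((restrictL2_ae _ _).trans ?_).symm)
    filter_upwards [ae_mono (Measure.restrict_mono_set volume (T.openHull_subset K K.2)) hpu,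
      ae_restrict_mem isOpen_interior.measurableSet] with x hx hxK
    exact hx (interior_subset hxK)
  let ρ : PolyL2 Ω T.elements m →ₗ[ℝ] ((K : T.elements) → W K) := LinearMap.pi fun K =>
    LinearMap.codRestrict (W K) (restrictL2 (T.openHull_subset K K.2) ∘ₗ Submodule.subtype _)
      fun u => hmem u K
  refine FiniteDimensional.of_injective ρ ?_
  rw [injective_iff_map_eq_zero]
  intro u hu
  have hK : ∀ K : T.elements, ∀ᵐ x : Plane, x ∈ hull K.1 → u.1 x = 0 := by
    intro K
    have h0 : restrictL2 (T.openHull_subset K K.2) u.1 = 0 :=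
      congrArg Subtype.val (congrFun hu K)
    have h1 := restrictL2_ae (T.openHull_subset K K.2) u.1
    rw [h0] at h1
    have h2 := (Lp.coeFn_zero ℝ 2 (volume.restrict (openHull K.1))).symm.trans h1
    have h3 := (ae_restrict_iff' isOpen_interior.measurableSet).1 h2
    have h4 : ∀ᵐ x : Plane, x ∉ frontier (hull K.1) :=
      measure_eq_zero_iff_ae_notMem.1 ((convex_convexHull ℝ _).addHaar_frontier volume)
    filter_upwards [h3, h4] with x hx hx' hxK
    have : x ∈ openHull K.1 := by
      by_contra hn
      exact hx' ⟨subset_closure hxK, hn⟩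
    simpa using (hx this).symm
  have hall : ∀ᵐ x : Plane, ∀ K : T.elements, x ∈ hull K.1 → u.1 x = 0 := ae_all_iff.2 hK
  refine Subtype.ext (Lp.ext (Filter.EventuallyEq.trans ?_
    (Lp.coeFn_zero ℝ 2 (volume.restrict Ω)).symm))
  have hcl : ∀ᵐ x ∂(volume.restrict Ω), x ∈ closure Ω := by
    have := ae_restrict_mem (μ := (volume : Measure Plane)) (isClosed_closure (s := Ω)).measurableSet
    exact ae_mono (Measure.restrict_mono_set volume subset_closure) this
  filter_upwards [ae_restrict_of_ae hall, hcl] with x hx hxΩ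
  rw [← T.cover] at hxΩ
  simp only [Set.mem_iUnion] at hxΩ
  obtain ⟨K, hKT, hxK⟩ := hxΩ
  exact hx ⟨K, hKT⟩ hxK

instance : FiniteDimensional ℝ (Qh T ℓ) := by
  have := finiteDimensional_PolyL2 T (ℓ - 2)
  exact Submodule.finiteDimensional_of_le (S₂ := PolyL2 Ω T.elements (ℓ - 2)) inf_le_left

/-- The discrete divergence of the discrete velocities with values in the discrete pressures, i.e.
the `L²(Ω)`-orthogonal projection of the divergence onto the discrete pressure space (see
`integral_mul_discDiv` for its characterization). -/
def discDiv : Vh T ℓ →ₗ[ℝ] Qh T ℓ :=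
  (Qh T ℓ).orthogonalProjectionOnto.toLinearMap ∘ₗ divergence Ω ∘ₗ toPair _

theorem integral_mul_discDiv (v : Vh T ℓ) (q : Qh T ℓ) :
    ∫ x in Ω, q.1 x * (discDiv T ℓ v).1 x
      = ∫ x in Ω, q.1 x * divergence Ω (toPair _ v) x := by
  rw [integral_mul_eq_inner, integral_mul_eq_inner]
  exact (Submodule.inner_orthogonalProjectionOnto_eq_of_mem_left q _).symm ▸ rfl

/-- The divergence correction `R_h v = ∑_K R_K (div_h v - div v)`. -/
def divCorrection : Vh T ℓ →ₗ[ℝ] (Fin 2 → H10 Ω) :=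
  ∑ K : T.elements, localRightInverse T ℓ K ∘ₗ
    ((Qh T ℓ).subtype ∘ₗ discDiv T ℓ - divergence Ω ∘ₗ toPair _)

/-- The bilinear form
`a_h(w, v) = ∫ ∇w : ∇v + ∫ ∇w : ∇R_h v + ∫ ∇R_h w : ∇v + η ∫ ∇R_h w : ∇R_h v`
on the discrete velocity space. -/
def ahub (η : ℝ) : LinearMap.BilinForm ℝ (Vh T ℓ) :=
  LinearMap.mk₂ ℝ
    (fun w v =>
      gradForm Ω (toPair _ w) (toPair _ v)
        + gradForm Ω (toPair _ w) (toPair _ (divCorrection T ℓ v))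
        + gradForm Ω (toPair _ (divCorrection T ℓ w)) (toPair _ v)
        + η * gradForm Ω (toPair _ (divCorrection T ℓ w)) (toPair _ (divCorrection T ℓ v)))
    (fun a b c => by simp only [map_add, LinearMap.add_apply]; ring)
    (fun a b c => by simp only [map_smul, LinearMap.smul_apply, smul_eq_mul]; ring)
    (fun a b c => by simp only [map_add]; ring)
    (fun a b c => by simp only [map_smul, smul_eq_mul]; ring)

end Global

end Stokes

end

/-!
Coercivity is an algebraic consequence of Young's inequality and holds for every linear correction
in place of `R_h`. Write `B = ∫ ∇· : ∇·`, a symmetric positive semidefinite form. Completing the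
square gives
`B(v, v) + 2 B(v, R_h v) + η B(R_h v, R_h v)
  = (1 - 1/η) B(v, v) + (1/η) B(v + η R_h v, v + η R_h v)`,
whose last term is nonnegative.
-/

namespace Stokes

open MeasureTheory

theorem gradForm_comm (U : Set Plane) (w v : Fin 2 → Pair U) :
    gradForm U w v = gradForm U v w := by
  change ∫ x in U, ∑ i, inner ℝ ((w i).2 x) ((v i).2 x)
    = ∫ x in U, ∑ i, inner ℝ ((v i).2 x) ((w i).2 x)
  simp only [real_inner_comm]

theorem gradForm_self (U : Set Plane) (v : Fin 2 → Pair U) :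
    gradForm U v v = gradNorm U v ^ 2 := by
  rw [gradNorm, Real.sq_sqrt (integral_nonneg fun x => by positivity)]
  change ∫ x in U, ∑ i, inner ℝ ((v i).2 x) ((v i).2 x) = _
  simp only [real_inner_self_eq_norm_sq]

/-- Young's inequality `-2 ∫ ∇v : ∇r ≤ (1/η) ‖∇v‖² + η ‖∇r‖²`, with the terms arranged as in
`ahub`. -/
theorem one_sub_mul_gradNorm_sq_le (U : Set Plane) (v r : Fin 2 → Pair U) {η : ℝ} (hη : 0 < η) :
    (1 - 1 / η) * gradNorm U v ^ 2
      ≤ gradForm U v v + gradForm U v r + gradForm U r v + η * gradForm U r r := by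
  have hsq : 0 ≤ gradForm U (v + η • r) (v + η • r) := by
    rw [gradForm_self]
    positivity
  have hexp : gradForm U v v + gradForm U v r + gradForm U r v + η * gradForm U r r
      = (1 - 1 / η) * gradForm U v v + 1 / η * gradForm U (v + η • r) (v + η • r) := by
    simp only [map_add, map_smul, LinearMap.add_apply, LinearMap.smul_apply, smul_eq_mul,
      gradForm_comm U r v]
    field_simp
    ring
  rw [hexp, ← gradForm_self]
  exact le_add_of_nonneg_right (by positivity)

end Stokes

theorem mainTheorem5 (Ω : Set Stokes.Plane) (hΩ : IsOpen Ω) (hb : Bornology.IsBounded Ω)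
    (T : Stokes.Triangulation Ω) (ℓ : ℕ) (hℓ : 2 ≤ ℓ) (η : ℝ) (hη : 1 < η) :
    (∃ α : ℝ, 0 < α ∧ ∀ v : Stokes.Vh T ℓ,
      α * Stokes.gradNorm Ω (Stokes.toPair _ v) ^ 2 ≤ Stokes.ahub T ℓ η v v) ∧
    ∀ v : Stokes.Vh T ℓ,
      Stokes.ahub T ℓ η v v ≥ (1 - 1 / η) * Stokes.gradNorm Ω (Stokes.toPair _ v) ^ 2 := by
  have hη0 : 0 < η := one_pos.trans hη
  have key : ∀ v : Stokes.Vh T ℓ,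
      (1 - 1 / η) * Stokes.gradNorm Ω (Stokes.toPair _ v) ^ 2 ≤ Stokes.ahub T ℓ η v v := fun v =>
    Stokes.one_sub_mul_gradNorm_sq_le Ω (Stokes.toPair _ v)
      (Stokes.toPair _ (Stokes.divCorrection T ℓ v)) hη0
  exact ⟨⟨1 - 1 / η, sub_pos.2 ((div_lt_one hη0).2 hη), key⟩, key⟩
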